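/- A graph property is a class of finite simple graphs closed under isomorphism. It is hereditary if it is closed under taking induced subgraphs, and non-trivial if it contains all edgeless graphs and misses some graph. For a non-trivial property $\mathcal{P}$ and a finite graph $G$, let $\mathrm{ex}(G,\mathcal{P})$ denote the maximum number of edges of a (not necessarily induced or spanning) subgraph of $G$ that belongs to $\mathcal{P}$. **Theorem 1.1.** Let $\mathcal{P}$ be a non-trivial hereditary property of graphs, and let $k=k(\mathcal{P})$ denote the minimum chromatic number of a graph that does not belong to $\mathcal{P}$. Then $k\ge 2$, and for every fixed $p\in(0,1)$ the binomial random graph $G=G(n,p)$ satisfies, with probability tending to $1$ as $n\to\infty$, $$\mathrm{ex}(G,\mathcal{P})=\left(1-\frac{1}{k-1}+o(1)\right)p\binom{n}{2},$$ where the $o(1)$-term tends to $0$ as $n$ tends to infinity. That is, there is a deterministic sequence $\delta_n\to 0$ (depending on $\mathcal{P}$ and $p$) such that $$\Pr\left[\left|\mathrm{ex}(G(n,p),\mathcal{P})-\left(1-\frac{1}{k-1}\right)p\binom{n}{2}\right|\le \delta_n\,p\binom{n}{2}\right]\longrightarrow 1\qquad(n\to\infty).$$ -/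

import Mathlib

open MeasureTheory Filter Topology

/-- A property of finite graphs: a class of finite simple graphs closed under isomorphism. -/
structure GraphProperty where
  Mem : ∀ (V : Type) [Finite V], SimpleGraph V → Prop
  mem_of_iso : ∀ {V W : Type} [Finite V] [Finite W] {G : SimpleGraph V} {H : SimpleGraph W},
    Nonempty (G ≃g H) → Mem V G → Mem W H

namespace GraphProperty

/-- `P` is closed under taking induced subgraphs. -/
def IsHereditary (P : GraphProperty) : Prop :=
  ∀ (V : Type) [Finite V] (G : SimpleGraph V) (s : Set V), P.Mem V G → P.Mem s (G.induce s)

/-- `P` contains all edgeless graphs and misses some graph. -/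
def IsNontrivial (P : GraphProperty) : Prop :=
  (∀ (V : Type) [Finite V], P.Mem V (⊥ : SimpleGraph V)) ∧
    ∃ (V : Type) (_ : Finite V) (L : SimpleGraph V), ¬ P.Mem V L

/-- The set of chromatic numbers of the finite graphs that do not belong to `P`. -/
def missedChromaticNumbers (P : GraphProperty) : Set ℕ :=
  {c | ∃ (V : Type) (_ : Finite V) (L : SimpleGraph V), ¬ P.Mem V L ∧ L.chromaticNumber = (c : ℕ∞)}

/-- `k(P)`: the minimum chromatic number of a graph that does not belong to `P`. -/
noncomputable def minMissedChromaticNumber (P : GraphProperty) : ℕ :=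
  sInf P.missedChromaticNumbers

/-- The numbers of edges of the (not necessarily spanning, not necessarily induced) subgraphs
of `G` that belong to `P`. -/
def subgraphEdgeCounts (P : GraphProperty) {V : Type} [Finite V] (G : SimpleGraph V) : Set ℕ :=
  {m | ∃ H : G.Subgraph, P.Mem H.verts H.coe ∧ H.edgeSet.ncard = m}

/-- `ex(G, P)`: the maximum number of edges of a subgraph of `G` that belongs to `P`. -/
noncomputable def ex (P : GraphProperty) {V : Type} [Finite V] (G : SimpleGraph V) : ℕ :=
  sSup (P.subgraphEdgeCounts G)

/-- For a non-trivial property the minimum defining `k(P)` exists. -/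
theorem isLeast_minMissedChromaticNumber {P : GraphProperty} (hP : P.IsNontrivial) :
    IsLeast P.missedChromaticNumbers P.minMissedChromaticNumber := by
  have hne : P.missedChromaticNumbers.Nonempty := by
    obtain ⟨V, hV, L, hL⟩ := hP.2
    have := Fintype.ofFinite V
    have hc : L.chromaticNumber ≠ ⊤ :=
      SimpleGraph.chromaticNumber_ne_top_iff_exists.2 ⟨_, L.colorable_of_fintype⟩
    exact ⟨L.chromaticNumber.toNat, V, hV, L, hL, (ENat.natCast_toNat hc).symm⟩
  exact ⟨Nat.sInf_mem hne, fun c hc => Nat.sInf_le hc⟩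

/-- For a non-trivial property the maximum defining `ex(G, P)` exists. -/
theorem isGreatest_ex {P : GraphProperty} (hP : P.IsNontrivial) {V : Type} [Finite V]
    (G : SimpleGraph V) : IsGreatest (P.subgraphEdgeCounts G) (P.ex G) := by
  have hne : (P.subgraphEdgeCounts G).Nonempty := by
    refine ⟨_, ⊥, ?_, rfl⟩
    have h : (⊥ : G.Subgraph).coe = ⊥ := by ext a b; simp
    rw [h]
    exact hP.1 _
  have hbd : BddAbove (P.subgraphEdgeCounts G) := by
    refine ⟨G.edgeSet.ncard, ?_⟩
    rintro m ⟨H, -, rfl⟩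
    exact Set.ncard_le_ncard H.edgeSet_subset (Set.toFinite _)
  exact ⟨Nat.sSup_mem hne hbd, fun m hm => le_csSup hbd hm⟩

end GraphProperty

/-!
The proof passes through a quasirandomness condition, `IsCutUniform`: against every product of
functions of the two endpoints, the edge indicator of `G` averages like the constant `p`, up to `ε`.
The binomial random graph satisfies it with high probability for every fixed `ε`
(`tendsto_binomialRandom_isCutUniform`): two Cauchy–Schwarz steps bound the cut norm by the
four-cycles weighted by `1_G - p`, whose expectation comes only from degenerate four-cycles. The
rest is deterministic.

For the lower bound, a `(k - 1)`-colourable graph belongs to `P`, and a random `(k - 1)`-colouring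
of the vertices leaves a proportion `1 - 1 / (k - 1)` of the edges of `G` bichromatic.

For the upper bound, let `L ∉ P` have chromatic number `k`, and let `H ≤ G` have more than
`(1 - 1 / (k - 1) + η) p (n choose 2)` edges. The replacement lemma
(`IsCutUniform.abs_expect_prod_sub_le`) allows an indicator of `G`, or of its complement, in an
average over vertex tuples to be exchanged for its density. It is used twice.
* Sample `m` vertices spanning a clique of `G`. Every edge of `H` is seen with nearly the same
  weight, so for a positive proportion of the samples `H` has density above `1 - 1 / (k - 1)` on the
  sample, and Erdős–Stone provides a copy of `L`. Hence a positive proportion of all maps from the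
  vertices of `L` to those of `G` are homomorphisms to `H`
  (`IsCutUniform.le_expect_of_forall_dense`). No regularity lemma is needed: the clique sample turns
  density relative to `G` into absolute density.
* Requiring in addition that non-edges of `L` go to non-edges of `G` costs only a factor of about
  `(1 - p)` per non-edge, so some map is an induced copy of `L` in `H`
  (`exists_induced_copy_of_dense`). A hereditary property containing `H` would then contain `L`.

The edge version of Erdős–Stone is deduced from Mathlib's minimum-degree version.
-/

namespace SimpleGraph

open Finset Function
open scoped BigOperators

/-! ### Uniform averages over functions -/

section Averages

variable {M W V : Type*} [Fintype M] [Fintype W] [Fintype V] [Nonempty V]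

/-- If `φ` is injective and `x` is a uniformly random function, then so is `x ∘ φ`. -/
lemma expect_comp_of_injective [DecidableEq M] [DecidableEq W] {φ : W → M} (hφ : Injective φ)
    (F : (W → V) → ℝ) : 𝔼 x : M → V, F (x ∘ φ) = 𝔼 y : W → V, F y := by
  -- exchanging the values of `x` on the range of `φ` with those of `y` is an involution
  have hinv : Involutive fun z : (M → V) × (W → V) ↦ (extend φ z.2 z.1, z.1 ∘ φ) := by
    rintro ⟨x, y⟩
    ext1
    · funext i
      by_cases hi : ∃ a, φ a = i
      · obtain ⟨a, rfl⟩ := hi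
        simp [hφ.extend_apply]
      · simp [extend_apply' _ _ _ hi]
    · funext a
      exact hφ.extend_apply _ _ a
  calc 𝔼 x : M → V, F (x ∘ φ) = 𝔼 x : M → V, 𝔼 _y : W → V, F (x ∘ φ) := by simp
    _ = 𝔼 z : (M → V) × (W → V), F (z.1 ∘ φ) := by
      rw [← univ_product_univ, expect_product]
    _ = 𝔼 z : (M → V) × (W → V), F z.2 :=
      Fintype.expect_bijective _ hinv.bijective _ _ fun z ↦ rfl
    _ = 𝔼 y : W → V, F y := by
      rw [← univ_product_univ, expect_product]; simp

/-- Resampling one coordinate does not change the average. -/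
lemma expect_expect_update [DecidableEq W] (a : W) (F : (W → V) → ℝ) :
    𝔼 x : W → V, 𝔼 u, F (update x a u) = 𝔼 x : W → V, F x := by
  have hinv : Involutive fun z : (W → V) × V ↦ (update z.1 a z.2, z.1 a) := by
    rintro ⟨x, u⟩
    simp
  calc 𝔼 x : W → V, 𝔼 u, F (update x a u) = 𝔼 z : (W → V) × V, F (update z.1 a z.2) := by
        rw [← univ_product_univ, expect_product]
    _ = 𝔼 z : (W → V) × V, F z.1 := Fintype.expect_bijective _ hinv.bijective _ _ fun z ↦ rfl
    _ = 𝔼 x : W → V, F x := by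
      rw [← univ_product_univ, expect_product]; simp

end Averages

/-! ### Cut-uniform graphs and the replacement lemma -/

section CutUniform

variable {V W : Type*}

open Classical in
/-- The real-valued indicator function of the edge set of a graph. -/
noncomputable def edgeInd (G : SimpleGraph V) (e : Sym2 V) : ℝ := if e ∈ G.edgeSet then 1 else 0

lemma edgeInd_of_mem {G : SimpleGraph V} {e : Sym2 V} (h : e ∈ G.edgeSet) : G.edgeInd e = 1 :=
  if_pos h

lemma edgeInd_of_notMem {G : SimpleGraph V} {e : Sym2 V} (h : e ∉ G.edgeSet) :
    G.edgeInd e = 0 := if_neg h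

lemma edgeInd_nonneg (G : SimpleGraph V) (e : Sym2 V) : 0 ≤ G.edgeInd e := by
  unfold edgeInd; split_ifs <;> norm_num

lemma edgeInd_le_one (G : SimpleGraph V) (e : Sym2 V) : G.edgeInd e ≤ 1 := by
  unfold edgeInd; split_ifs <;> norm_num

lemma mem_edgeSet_of_edgeInd_ne_zero {G : SimpleGraph V} {e : Sym2 V} (h : G.edgeInd e ≠ 0) :
    e ∈ G.edgeSet := by
  by_contra h'
  exact h (edgeInd_of_notMem h')

lemma edgeInd_mul_of_le {H G : SimpleGraph V} (h : H ≤ G) (e : Sym2 V) :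
    H.edgeInd e * G.edgeInd e = H.edgeInd e := by
  by_cases he : e ∈ H.edgeSet
  · rw [edgeInd_of_mem he, edgeInd_of_mem (edgeSet_mono h he), one_mul]
  · rw [edgeInd_of_notMem he, zero_mul]

/-- `G` is `ε`-close in normalised cut norm to the constant weight `p`: against every product of
`[0, 1]`-valued functions of the two endpoints, the edge indicator of `G` averages as `p` does,
up to an error `ε`. -/
def IsCutUniform [Fintype V] (G : SimpleGraph V) (p ε : ℝ) : Prop :=
  ∀ A B : V → ℝ, (∀ v, A v ∈ Set.Icc 0 1) → (∀ v, B v ∈ Set.Icc 0 1) →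
    |𝔼 u, 𝔼 v, A u * B v * (G.edgeInd s(u, v) - p)| ≤ ε

lemma IsCutUniform.mono [Fintype V] {G : SimpleGraph V} {p ε ε' : ℝ} (h : G.IsCutUniform p ε)
    (hε : ε ≤ ε') : G.IsCutUniform p ε' := fun A B hA hB ↦ (h A B hA hB).trans hε

/-- The complement of a cut-uniform graph is cut-uniform; the diagonal costs `1 / |V|`. -/
lemma IsCutUniform.compl [Fintype V] [Nonempty V] {G : SimpleGraph V} {p ε : ℝ}
    (h : G.IsCutUniform p ε) : Gᶜ.IsCutUniform (1 - p) (ε + 1 / Fintype.card V) := by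
  classical
  intro A B hA hB
  have key : ∀ u v, A u * B v * (Gᶜ.edgeInd s(u, v) - (1 - p))
      = -(A u * B v * (G.edgeInd s(u, v) - p)) - (if u = v then A u * B v else 0) := by
    intro u v
    unfold edgeInd
    by_cases huv : u = v
    · subst huv; simp; ring
    · by_cases hG : G.Adj u v <;> simp [huv, hG]
      ring
  simp_rw [key, expect_sub_distrib, expect_neg_distrib]
  have h2 : |𝔼 u, 𝔼 v, (if u = v then A u * B v else 0)| ≤ 1 / (Fintype.card V : ℝ) := by
    refine (abs_expect_le _ _).trans (expect_le univ_nonempty fun u _ ↦ ?_)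
    rw [Fintype.expect_eq_sum_div_card]
    simp only [sum_ite_eq, mem_univ, if_true]
    rw [abs_of_nonneg (div_nonneg (mul_nonneg (hA u).1 (hB u).1) (Nat.cast_nonneg _))]
    gcongr
    exact mul_le_one₀ (hA u).2 (hB u).1 (hB u).2
  have h1 := h A B hA hB
  rw [abs_le] at *
  constructor <;> linarith

/-- A `[0, 1]`-valued function of `x : W → V` splits at `a, b` if it is a product of a
`[0, 1]`-valued function that ignores `x a` and one that ignores `x b`. -/
def Splits [DecidableEq W] (a b : W) (F : (W → V) → ℝ) : Prop :=
  ∃ A B : (W → V) → ℝ, (∀ x, A x ∈ Set.Icc 0 1) ∧ (∀ x, B x ∈ Set.Icc 0 1) ∧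
    (∀ x u, A (update x a u) = A x) ∧ (∀ x u, B (update x b u) = B x) ∧ ∀ x, F x = A x * B x

lemma Splits.of_left [DecidableEq W] {a b : W} {F : (W → V) → ℝ} (h : ∀ x, F x ∈ Set.Icc 0 1)
    (ha : ∀ x u, F (update x a u) = F x) : Splits a b F :=
  ⟨F, fun _ ↦ 1, h, by simp, ha, by simp, by simp⟩

lemma Splits.of_right [DecidableEq W] {a b : W} {F : (W → V) → ℝ} (h : ∀ x, F x ∈ Set.Icc 0 1)
    (hb : ∀ x u, F (update x b u) = F x) : Splits a b F :=
  ⟨fun _ ↦ 1, F, by simp, h, by simp, hb, by simp⟩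

lemma Splits.mul [DecidableEq W] {a b : W} {F F' : (W → V) → ℝ} (h : Splits a b F)
    (h' : Splits a b F') : Splits a b fun x ↦ F x * F' x := by
  obtain ⟨A, B, hA, hB, hAa, hBb, hF⟩ := h
  obtain ⟨A', B', hA', hB', hAa', hBb', hF'⟩ := h'
  refine ⟨fun x ↦ A x * A' x, fun x ↦ B x * B' x,
    fun x ↦ ⟨mul_nonneg (hA x).1 (hA' x).1, mul_le_one₀ (hA x).2 (hA' x).1 (hA' x).2⟩,
    fun x ↦ ⟨mul_nonneg (hB x).1 (hB' x).1, mul_le_one₀ (hB x).2 (hB' x).1 (hB' x).2⟩,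
    fun x u ↦ by simp only [hAa, hAa'], fun x u ↦ by simp only [hBb, hBb'], fun x ↦ ?_⟩
  simp only [hF, hF']; ring

lemma Splits.prod [DecidableEq W] {ι : Type*} {a b : W} (s : Finset ι) {F : ι → (W → V) → ℝ}
    (h : ∀ i ∈ s, Splits a b (F i)) : Splits a b fun x ↦ ∏ i ∈ s, F i x := by
  classical
  induction s using Finset.induction_on with
  | empty => simpa using! Splits.of_left (F := fun _ : W → V ↦ (1 : ℝ)) (by simp) (by simp)
  | insert i s hi ih =>
    simp only [prod_insert hi]
    exact (h i (mem_insert_self _ _)).mul (ih fun j hj ↦ h j (mem_insert_of_mem hj))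

lemma map_update_of_notMem [DecidableEq W] {a : W} {e : Sym2 W} (ha : a ∉ e) (x : W → V) (u : V) :
    e.map (update x a u) = e.map x := by
  refine Sym2.map_congr fun c hc ↦ update_of_ne ?_ _ _
  rintro rfl
  exact ha hc

/-- An edge indicator splits at every pair other than its own edge. -/
lemma splits_edgeInd [DecidableEq W] {a b : W} {e : Sym2 W} (hab : a ≠ b) (he : e ≠ s(a, b))
    (G : SimpleGraph V) : Splits a b fun x ↦ G.edgeInd (e.map x) := by
  have h : ∀ x : W → V, G.edgeInd (e.map x) ∈ Set.Icc 0 1 :=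
    fun x ↦ ⟨edgeInd_nonneg _ _, edgeInd_le_one _ _⟩
  by_cases ha : a ∈ e
  · have hb : b ∉ e := fun hb ↦ he ((Sym2.mem_and_mem_iff hab).1 ⟨ha, hb⟩)
    exact .of_right h fun x u ↦ by rw [map_update_of_notMem hb]
  · exact .of_left h fun x u ↦ by rw [map_update_of_notMem ha]

/-- In a cut-uniform graph, one edge indicator in an average may be replaced by its density when
the remaining factor splits at that edge. -/
lemma IsCutUniform.abs_expect_splits_le [Fintype V] [Nonempty V] [Fintype W] [DecidableEq W]
    {G : SimpleGraph V} {p ε : ℝ} (h : G.IsCutUniform p ε) {a b : W} (hab : a ≠ b)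
    {F : (W → V) → ℝ} (hF : Splits a b F) :
    |𝔼 x : W → V, F x * (G.edgeInd s(x a, x b) - p)| ≤ ε := by
  obtain ⟨A, B, hA, hB, hAa, hBb, hF⟩ := hF
  rw [← expect_expect_update b, ← expect_expect_update a]
  refine (abs_expect_le _ _).trans (expect_le univ_nonempty fun x _ ↦ ?_)
  refine le_trans (le_of_eq ?_) (h (fun u ↦ B (update x a u)) (fun v ↦ A (update x b v))
    (fun u ↦ hB _) fun v ↦ hA _)
  congr 1
  refine expect_congr rfl fun u _ ↦ expect_congr rfl fun v _ ↦ ?_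
  rw [hF, hBb, update_comm hab, hAa]
  simp [hab.symm, mul_comm]

/-- **Replacement lemma.** In a cut-uniform graph, every edge indicator of a product may be replaced
by the density when the remaining factor splits at all the edges concerned. -/
lemma IsCutUniform.abs_expect_prod_sub_le [Fintype V] [Nonempty V] [Fintype W] [DecidableEq W]
    {G : SimpleGraph V} {p ε : ℝ} (h : G.IsCutUniform p ε) (hp : p ∈ Set.Icc 0 1)
    {F : (W → V) → ℝ} (S : Finset (Sym2 W)) (hS : ∀ e ∈ S, ¬ e.IsDiag)
    (hF : ∀ a b, s(a, b) ∈ S → Splits a b F) :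
    |(𝔼 x : W → V, F x * ∏ e ∈ S, G.edgeInd (e.map x)) - p ^ #S * 𝔼 x : W → V, F x|
      ≤ #S * ε := by
  induction S using Finset.induction_on with
  | empty => simp
  | insert e S he ih =>
    specialize ih (fun e he ↦ hS e (mem_insert_of_mem he))
      (fun a b hab ↦ hF a b (mem_insert_of_mem hab))
    induction e using Sym2.ind with
    | _ a b =>
    have hab : a ≠ b := by simpa using hS _ (mem_insert_self _ _)
    have h1 := h.abs_expect_splits_le hab ((hF a b (mem_insert_self _ _)).mul
      (Splits.prod S (F := fun e (x : W → V) ↦ G.edgeInd (e.map x)) fun e' he' ↦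
        splits_edgeInd hab (fun hh ↦ he (hh ▸ he')) G))
    have h2 : (𝔼 x : W → V, F x * ∏ e ∈ insert s(a, b) S, G.edgeInd (e.map x))
          - p ^ #(insert s(a, b) S) * 𝔼 x : W → V, F x
        = (𝔼 x : W → V, F x * (∏ e ∈ S, G.edgeInd (e.map x)) * (G.edgeInd s(x a, x b) - p))
          + p * ((𝔼 x : W → V, F x * ∏ e ∈ S, G.edgeInd (e.map x)) - p ^ #S * 𝔼 x : W → V, F x) := by
      rw [card_insert_of_notMem he, mul_sub p, ← add_sub_assoc, mul_expect _ _ p,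
        ← expect_add_distrib, pow_succ']
      congr 1
      · refine expect_congr rfl fun x _ ↦ ?_
        rw [prod_insert he]
        simp only [Sym2.map_mk]
        ring
      · ring
    rw [h2, card_insert_of_notMem he]
    refine (abs_add_le _ _).trans ?_
    rw [abs_mul, abs_of_nonneg hp.1]
    have h3 := mul_le_of_le_one_left (abs_nonneg ((𝔼 x : W → V, F x * ∏ e ∈ S, G.edgeInd (e.map x))
      - p ^ #S * 𝔼 x : W → V, F x)) hp.2
    push_cast
    linarith

end CutUniform

end SimpleGraph

/-! ### The edge version of the Erdős–Stone theorem -/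

namespace SimpleGraph

open Finset Function
open scoped BigOperators

/-- The **Erdős–Stone theorem** for the extremal numbers of `K_{r+1}(t)`. This is deduced from
the minimum-degree version: deleting a vertex of minimum degree from an extremal graph shows that
consecutive extremal numbers differ by at most `(1 - 1 / r + ε) n`. -/
lemma eventually_extremalNumber_completeEquipartiteGraph_le {ε : ℝ} (hε : 0 < ε) {r : ℕ}
    (hr : 0 < r) (t : ℕ) : ∀ᶠ n in atTop,
      (extremalNumber n (completeEquipartiteGraph (r + 1) t) : ℝ)
        ≤ (1 - 1 / r + ε) * n.choose 2 := by
  classical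
  have hr1 : (0 : ℝ) ≤ 1 - 1 / r := by
    rw [sub_nonneg, div_le_one (by positivity)]; exact_mod_cast hr
  obtain ⟨N, hN⟩ := eventually_atTop.1
    (eventually_completeEquipartiteGraph_isContained_of_minDegree (half_pos hε) r t)
  set K := completeEquipartiteGraph (r + 1) t
  have hstep : ∀ n, N ≤ n → (extremalNumber (n + 1) K : ℝ)
      ≤ extremalNumber n K + (1 - 1 / r + ε / 2) * (n + 1) := by
    intro n hn
    have h0 : (0 : ℝ) ≤ extremalNumber n K + (1 - 1 / r + ε / 2) * (n + 1) := by positivity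
    have := (extremalNumber_le_iff_of_nonneg (V := Fin (n + 1)) K h0).2 ?_
    · simpa using this
    intro G _ hG
    obtain ⟨v, hv⟩ := G.exists_minimal_degree_vertex
    have hdeg : (G.minDegree : ℝ) < (1 - 1 / r + ε / 2) * (n + 1) := by
      by_contra! hge
      exact hG (hN (n + 1) (by omega) (by push_cast; exact hge))
    have hdel := card_edgeFinset_deleteIncidenceSet_le_extremalNumber hG v
    rw [card_edgeFinset_deleteIncidenceSet, Fintype.card_fin, Nat.add_sub_cancel, ← hv] at hdel
    have : (#G.edgeFinset : ℝ) ≤ extremalNumber n K + G.minDegree := by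
      exact_mod_cast (by omega : #G.edgeFinset ≤ extremalNumber n K + G.minDegree)
    linarith
  have hsum : ∀ n, N ≤ n → (extremalNumber n K : ℝ)
      ≤ extremalNumber N K + (1 - 1 / r + ε / 2) * (n * (n + 1) / 2) := by
    intro n hn
    induction n, hn using Nat.le_induction with
    | base =>
      have : (0 : ℝ) ≤ (1 - 1 / r + ε / 2) * (N * (N + 1) / 2) := by positivity
      linarith
    | succ n hn ih =>
      refine (hstep n hn).trans ?_
      push_cast
      linarith
  -- the difference of the two bounds is quadratic in `n` with leading coefficient `ε / 4`
  set C := (extremalNumber N K : ℝ)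
  set α : ℝ := 1 - 1 / r
  obtain ⟨N', hN'⟩ := exists_nat_gt ((C + α + ε) * (4 / ε) + 1)
  filter_upwards [eventually_ge_atTop N, eventually_ge_atTop N'] with n hn hn'
  refine (hsum n hn).trans ?_
  have hn1 : (C + α + ε) * (4 / ε) + 1 < n := hN'.trans_le (by exact_mod_cast hn')
  have hC : 0 ≤ C := Nat.cast_nonneg _
  have hn2 : C + α + ε < (n - 1) * (ε / 4) := by
    have := mul_lt_mul_of_pos_right (lt_sub_iff_add_lt.2 hn1) (show 0 < ε / 4 by positivity)
    rwa [mul_assoc, show (4 / ε) * (ε / 4) = 1 by field_simp, mul_one] at this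
  have hn3 : (1 : ℝ) ≤ n := by
    have : 0 ≤ (C + α + ε) * (4 / ε) := by positivity
    linarith
  rw [Nat.cast_choose_two]
  nlinarith [mul_le_mul_of_nonneg_right hn2.le (show (0 : ℝ) ≤ n by linarith),
    mul_le_mul_of_nonneg_left hn3 hC]

end SimpleGraph

/-! ### Sampling cliques -/

namespace SimpleGraph

open Finset Function
open scoped BigOperators

section Sampling

variable {V W : Type*} [Fintype V] [Nonempty V]

lemma ncard_edgeSet_eq_sum_edgeInd {X : Type*} [Fintype X] [DecidableEq X] (H : SimpleGraph X) :
    (H.edgeSet.ncard : ℝ) = ∑ e ∈ (⊤ : SimpleGraph X).edgeFinset, H.edgeInd e := by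
  classical
  have h : H.edgeSet.ncard = #{e ∈ (⊤ : SimpleGraph X).edgeFinset | e ∈ H.edgeSet} := by
    rw [← Set.ncard_coe_finset]
    congr 1
    ext e
    simpa using fun he ↦ H.not_isDiag_of_mem_edgeSet he
  rw [h, card_filter, Nat.cast_sum]
  refine sum_congr rfl fun e _ ↦ ?_
  unfold edgeInd
  split_ifs <;> simp

/-- A non-degenerate pair is mapped by a uniformly random function to an edge of `H` with
probability `2 e(H) / |V| ^ 2`. -/
lemma expect_edgeInd_map [Fintype W] [DecidableEq W] (H : SimpleGraph V) {e : Sym2 W}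
    (he : ¬ e.IsDiag) :
    𝔼 x : W → V, H.edgeInd (e.map x) = 2 * H.edgeSet.ncard / (Fintype.card V : ℝ) ^ 2 := by
  classical
  induction e using Sym2.ind with
  | _ a b =>
  have hab : a ≠ b := by simpa using he
  have hφ : Injective ![a, b] := by
    intro i j hij
    fin_cases i <;> fin_cases j <;> simp_all
  have h1 := expect_comp_of_injective hφ fun y : Fin 2 → V ↦ H.edgeInd s(y 0, y 1)
  simp only [comp_apply, Matrix.cons_val_zero, Matrix.cons_val_one] at h1
  simp only [Sym2.map_mk]
  rw [h1, Fintype.expect_eq_sum_div_card, Fintype.card_fun, Fintype.card_fin]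
  push_cast
  congr 1
  rw [Fintype.sum_equiv (finTwoArrowEquiv V) _ (fun z ↦ H.edgeInd s(z.1, z.2))
    (fun y ↦ by simp [finTwoArrowEquiv]), Fintype.sum_prod_type]
  have h2 : ∀ u, ∑ v, H.edgeInd s(u, v) = H.degree u := by
    intro u
    rw [← card_neighborFinset_eq_degree, neighborFinset_eq_filter, card_filter, Nat.cast_sum]
    refine sum_congr rfl fun v _ ↦ ?_
    simp [edgeInd]
  simp only [h2]
  rw [← coe_edgeFinset, Set.ncard_coe_finset]
  exact_mod_cast H.sum_degrees_eq_twice_card_edges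

/-- Sample `m` vertices of the cut-uniform graph `G` conditioned on spanning a clique. If every
sample in which `H ≤ G` has more than a proportion `θ` of the edges contains a copy of the pattern
with indicator `F`, and `H` has relative density above `θ` in `G`, then `F` has a positive
average. -/
lemma IsCutUniform.le_expect_of_forall_dense [Fintype W] [DecidableEq W] {G H : SimpleGraph V}
    {p ε θ : ℝ} (hG : G.IsCutUniform p ε) (hp : p ∈ Set.Icc 0 1) (hHG : H ≤ G) {m : ℕ} (hm : 2 ≤ m)
    (hθ : 0 ≤ θ) {F : (W → V) → ℝ} (hF : ∀ y, 0 ≤ F y)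
    (h : ∀ x : Fin m → V, θ * m.choose 2 < (H.comap x).edgeSet.ncard →
      ∃ φ : W → Fin m, Injective φ ∧ 1 ≤ F (x ∘ φ)) :
    p ^ (m.choose 2 - 1) * (2 * H.edgeSet.ncard / (Fintype.card V : ℝ) ^ 2 - θ * p)
        - (1 + θ) * m.choose 2 * ε
      ≤ (m : ℝ) ^ Fintype.card W * 𝔼 y, F y := by
  classical
  set T := (⊤ : SimpleGraph (Fin m)).edgeFinset with hT
  set N := m.choose 2 with hN
  have hTN : #T = N := by rw [hT, card_edgeFinset_top_eq_card_choose_two, Fintype.card_fin]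
  have hN0 : 0 < N := Nat.choose_pos hm
  have hN1 : (1 : ℝ) ≤ N := by exact_mod_cast hN0
  set D := 2 * H.edgeSet.ncard / (Fintype.card V : ℝ) ^ 2
  have hTd : ∀ e ∈ T, ¬ e.IsDiag := by
    intro e he
    simpa [hT] using he
  set Cl : (Fin m → V) → ℝ := fun x ↦ ∏ e ∈ T, G.edgeInd (e.map x) with hCl
  have hCl0 : ∀ x, 0 ≤ Cl x := fun x ↦ prod_nonneg fun e _ ↦ edgeInd_nonneg _ _
  have hCl1 : ∀ x, Cl x ≤ 1 :=
    fun x ↦ prod_le_one (fun e _ ↦ edgeInd_nonneg _ _) fun e _ ↦ edgeInd_le_one _ _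
  have hε : 0 ≤ ε := (abs_nonneg _).trans (hG (fun _ ↦ 0) (fun _ ↦ 0) (by simp) (by simp))
  -- the density of cliques
  have hcl : 𝔼 x, Cl x ≤ p ^ N + N * ε := by
    have := hG.abs_expect_prod_sub_le hp (F := fun _ : Fin m → V ↦ 1) T hTd
      fun a b _ ↦ .of_left (by simp) (by simp)
    simp only [one_mul, Fintype.expect_const, mul_one, hTN] at this
    linarith [(abs_le.1 this).2]
  -- the density of cliques with a prescribed pair in `H`
  have hedge : ∀ e ∈ T, p ^ (N - 1) * D - N * ε ≤ 𝔼 x, Cl x * H.edgeInd (e.map x) := by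
    intro e he
    have := hG.abs_expect_prod_sub_le hp (F := fun x : Fin m → V ↦ H.edgeInd (e.map x))
      (T.erase e) (fun e' he' ↦ hTd e' (mem_of_mem_erase he')) fun a b hab ↦
        splits_edgeInd (by simpa using hTd _ (mem_of_mem_erase hab)) (ne_of_mem_erase hab).symm H
    rw [card_erase_of_mem he, hTN, expect_edgeInd_map H (hTd e he)] at this
    have hN' : ((N - 1 : ℕ) : ℝ) * ε ≤ N * ε := by gcongr; omega
    have heq : ∀ x : Fin m → V, H.edgeInd (e.map x) * ∏ e' ∈ T.erase e, G.edgeInd (e'.map x)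
        = Cl x * H.edgeInd (e.map x) := by
      intro x
      rw [hCl]
      simp only
      rw [← mul_prod_erase T _ he, ← edgeInd_mul_of_le hHG (e.map x)]
      have := edgeInd_mul_of_le hHG (e.map x)
      rw [this, mul_comm _ (H.edgeInd _), ← mul_assoc, this]
    simp only [heq] at this
    linarith [(abs_le.1 this).1]
  -- a clique sample either carries few edges of `H` or contains a copy of the pattern
  have hpt : ∀ x, ∑ e ∈ T, Cl x * H.edgeInd (e.map x)
      ≤ θ * N * Cl x + N * ∑ φ : W → Fin m, if Injective φ then F (x ∘ φ) else 0 := by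
    intro x
    have hcount : ∑ e ∈ T, H.edgeInd (e.map x) = (H.comap x).edgeSet.ncard := by
      rw [ncard_edgeSet_eq_sum_edgeInd]
      refine sum_congr rfl fun e _ ↦ ?_
      induction e using Sym2.ind with
      | _ a b => simp [edgeInd]
    have hnn : ∀ φ : W → Fin m, 0 ≤ (if Injective φ then F (x ∘ φ) else 0) := by
      intro φ
      split_ifs
      exacts [hF _, le_rfl]
    rw [← mul_sum, hcount]
    by_cases hx : θ * N < (H.comap x).edgeSet.ncard
    · obtain ⟨φ, hφ, hFφ⟩ := h x hx
      have h1 : (1 : ℝ) ≤ ∑ φ : W → Fin m, if Injective φ then F (x ∘ φ) else 0 := by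
        refine le_trans ?_ (single_le_sum (fun φ _ ↦ hnn φ) (mem_univ φ))
        rwa [if_pos hφ]
      have h2 : ((H.comap x).edgeSet.ncard : ℝ) ≤ N := by
        rw [← hcount, ← hTN]
        refine (sum_le_sum fun e _ ↦ edgeInd_le_one H (e.map x)).trans (by simp)
      have h3 : Cl x * (H.comap x).edgeSet.ncard ≤ 1 * N := by
        gcongr
        exact hCl1 x
      have h4 := mul_le_mul_of_nonneg_left h1 (zero_le_one.trans hN1)
      have h5 : 0 ≤ θ * N * Cl x := mul_nonneg (by positivity) (hCl0 x)
      linarith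
    · have h1 := mul_le_mul_of_nonneg_left (not_lt.1 hx) (hCl0 x)
      have h2 : 0 ≤ (N : ℝ) * ∑ φ : W → Fin m, if Injective φ then F (x ∘ φ) else 0 :=
        mul_nonneg (Nat.cast_nonneg _) (sum_nonneg fun φ _ ↦ hnn φ)
      linarith
  have havg := expect_le_expect (s := univ) fun x _ ↦ hpt x
  rw [expect_sum_comm, expect_add_distrib, ← mul_expect, ← mul_expect, expect_sum_comm] at havg
  have hlow : N * (p ^ (N - 1) * D - N * ε) ≤ ∑ e ∈ T, 𝔼 x, Cl x * H.edgeInd (e.map x) := by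
    have := card_nsmul_le_sum T _ _ hedge
    rwa [hTN, nsmul_eq_mul] at this
  have hup : ∑ φ : W → Fin m, 𝔼 x : Fin m → V, (if Injective φ then F (x ∘ φ) else 0)
      ≤ (m : ℝ) ^ Fintype.card W * 𝔼 y, F y := by
    have : ∀ φ : W → Fin m, 𝔼 x : Fin m → V, (if Injective φ then F (x ∘ φ) else 0)
        ≤ 𝔼 y, F y := by
      intro φ
      by_cases hφ : Injective φ
      · simp only [if_pos hφ]
        exact (expect_comp_of_injective hφ F).le
      · simpa only [if_neg hφ, expect_const_zero] using expect_nonneg fun y _ ↦ hF y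
    refine (sum_le_card_nsmul _ _ _ fun φ _ ↦ this φ).trans (le_of_eq ?_)
    simp
  have hcl' := mul_le_mul_of_nonneg_left hcl (mul_nonneg hθ (zero_le_one.trans hN1))
  have hup' := mul_le_mul_of_nonneg_left hup (zero_le_one.trans hN1)
  have hpN : p ^ N = p ^ (N - 1) * p := by rw [← pow_succ, Nat.sub_add_cancel hN0]
  refine le_of_mul_le_mul_left ?_ (zero_lt_one.trans_le hN1)
  rw [hpN] at hcl'
  linarith

end Sampling

end SimpleGraph

/-! ### Induced copies in dense subgraphs -/

namespace SimpleGraph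

open Finset Function
open scoped BigOperators

section Embedding

variable {V W : Type*} [Fintype W]

open Classical in
/-- The indicator that `y : W → V` maps the edges of `L` to edges of `H` and all vertices to
non-isolated vertices of `H`. The second condition matters when `H` is a subgraph extended by
isolated vertices to the whole vertex set: a copy of `L` must not use the added vertices. -/
noncomputable def homInd (L : SimpleGraph W) (H : SimpleGraph V) (y : W → V) : ℝ :=
  (∏ e ∈ L.edgeFinset, H.edgeInd (e.map y)) * ∏ w, if y w ∈ H.support then 1 else 0

lemma homInd_nonneg (L : SimpleGraph W) (H : SimpleGraph V) (y : W → V) : 0 ≤ homInd L H y :=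
  mul_nonneg (prod_nonneg fun e _ ↦ edgeInd_nonneg _ _)
    (prod_nonneg fun w _ ↦ by split_ifs <;> norm_num)

lemma homInd_eq_one {L : SimpleGraph W} {H : SimpleGraph V} {y : W → V}
    (h : ∀ a b, L.Adj a b → H.Adj (y a) (y b)) (hs : ∀ w, y w ∈ H.support) :
    homInd L H y = 1 := by
  classical
  have h1 : ∏ e ∈ L.edgeFinset, H.edgeInd (e.map y) = 1 := by
    refine prod_eq_one fun e he ↦ ?_
    induction e using Sym2.ind with
    | _ a b => exact edgeInd_of_mem (h a b (by simpa using he))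
  rw [homInd, h1, prod_eq_one fun w _ ↦ if_pos (hs w), one_mul]

lemma of_homInd_ne_zero {L : SimpleGraph W} {H : SimpleGraph V} {y : W → V}
    (h : homInd L H y ≠ 0) :
    (∀ a b, L.Adj a b → H.Adj (y a) (y b)) ∧ ∀ w, y w ∈ H.support := by
  classical
  obtain ⟨h1, h2⟩ := mul_ne_zero_iff.1 h
  rw [prod_ne_zero_iff] at h1 h2
  refine ⟨fun a b hab ↦ mem_edgeSet_of_edgeInd_ne_zero (h1 s(a, b) (by simpa using hab)),
    fun w ↦ ?_⟩
  by_contra hw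
  exact h2 w (mem_univ w) (if_neg hw)

/-- The indicator of homomorphisms from `L` splits at every non-edge of `L`. -/
lemma splits_homInd [DecidableEq W] {L : SimpleGraph W} (H : SimpleGraph V) {a b : W}
    (hab : Lᶜ.Adj a b) : Splits a b (homInd L H) := by
  classical
  refine Splits.mul (Splits.prod _ fun e he ↦ splits_edgeInd hab.ne ?_ H)
    (Splits.prod _ fun w _ ↦ ?_)
  · rintro rfl
    exact hab.2 (by simpa using he)
  · have h01 : ∀ x : W → V, (if x w ∈ H.support then (1 : ℝ) else 0) ∈ Set.Icc 0 1 := by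
      intro x
      split_ifs <;> simp
    by_cases hw : w = a
    · have hwb : w ≠ b := hw ▸ hab.ne
      exact .of_right h01 fun x u ↦ by rw [update_of_ne hwb]
    · exact .of_left h01 fun x u ↦ by rw [update_of_ne hw]

/-- If the pullback of `H` along `x : Fin m → V` has more edges than a `K_{r+1}(|W|)`-free graph
can have, then it contains `L`, and no vertex of the copy is isolated. -/
lemma exists_one_le_homInd {L : SimpleGraph W} {r : ℕ} (hr : 0 < r) (hL : L.Colorable (r + 1))
    (H : SimpleGraph V) {m : ℕ} (x : Fin m → V)
    (h : extremalNumber m (completeEquipartiteGraph (r + 1) (Fintype.card W))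
      < (H.comap x).edgeSet.ncard) :
    ∃ φ : W → Fin m, Injective φ ∧ 1 ≤ homInd L H (x ∘ φ) := by
  classical
  obtain ⟨C⟩ := hL
  obtain ⟨f⟩ := isContained_completeEquipartiteGraph_of_colorable C (Fintype.card W)
    fun c ↦ Fintype.card_subtype_le _
  obtain ⟨g⟩ : completeEquipartiteGraph (r + 1) (Fintype.card W) ⊑ H.comap x := by
    refine IsContained.of_extremalNumber_lt_card_edgeFinset ?_
    rwa [Fintype.card_fin, ← Set.ncard_coe_finset, coe_edgeFinset]
  have hadj : ∀ v w, (completeEquipartiteGraph (r + 1) (Fintype.card W)).Adj v w →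
      H.Adj (x (g v)) (x (g w)) := fun v w hvw ↦ g.toHom.map_adj hvw
  refine ⟨g ∘ f, g.injective.comp f.injective, (homInd_eq_one ?_ fun w ↦ ?_).ge⟩
  · exact fun a b hab ↦ hadj _ _ (f.toHom.map_adj hab)
  · have : Nontrivial (Fin (r + 1)) := Fin.nontrivial_iff_two_le.2 (by omega)
    obtain ⟨c, hc⟩ := exists_ne (f w).1
    exact ⟨_, hadj (f w) (c, (f w).2) (by simpa using hc.symm)⟩

end Embedding

/-- **Induced copies in dense subgraphs of quasirandom graphs.** If `G` is sufficiently cut-uniform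
of density `p` and `H ≤ G` has more than `(1 - 1 / r + η) p (n choose 2)` edges, then `H` contains
an induced copy of every `(r + 1)`-colourable graph, avoiding the isolated vertices of `H`. -/
theorem exists_induced_copy_of_dense {W : Type*} [Finite W] {L : SimpleGraph W} {r : ℕ}
    (hr : 0 < r) (hL : L.Colorable (r + 1)) {p η : ℝ} (hp0 : 0 < p) (hp1 : p < 1) (hη : 0 < η) :
    ∃ ε > 0, ∃ n₀ : ℕ, ∀ n ≥ n₀, ∀ G H : SimpleGraph (Fin n), H ≤ G → G.IsCutUniform p ε →
      (1 - 1 / r + η) * p * n.choose 2 < H.edgeSet.ncard →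
      ∃ f : L ↪g H, ∀ w, f w ∈ H.support := by
  classical
  have := Fintype.ofFinite W
  set α : ℝ := 1 - 1 / r with hα
  have hα0 : 0 ≤ α := by
    rw [hα, sub_nonneg, div_le_one (by positivity)]; exact_mod_cast hr
  obtain ⟨m, hm, hm2⟩ := ((eventually_extremalNumber_completeEquipartiteGraph_le (half_pos hη) hr
    (Fintype.card W)).and (eventually_ge_atTop 2)).exists
  have hm0 : (0 : ℝ) < m := by positivity
  set N := m.choose 2
  set q := #Lᶜ.edgeFinset
  -- `s` bounds both the cut-norm error and `1 / n`; as `s → 0`, the lower bound for the density of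
  -- induced copies of `L` tends to a positive limit
  let Φ : ℝ → ℝ := fun s ↦ (1 - p) ^ q *
    ((p ^ (N - 1) * (p * (η / 2) - (α + η) * p * s) - (1 + (α + η / 2)) * N * s)
      / (m : ℝ) ^ Fintype.card W) - q * (s + s)
  have hΦ0 : 0 < Φ 0 := by
    have : 0 < 1 - p := by linarith
    simp only [Φ, mul_zero, sub_zero, add_zero]
    positivity
  have hΦc : Continuous Φ := by fun_prop
  obtain ⟨s, hs, hs0⟩ : ∃ s, 0 < Φ s ∧ 0 < s :=
    ((((hΦc.tendsto 0).eventually_const_lt hΦ0).filter_mono nhdsWithin_le_nhds).and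
      (self_mem_nhdsWithin (s := Set.Ioi 0))).exists
  obtain ⟨n₀, hn₀⟩ := exists_nat_gt (1 / s)
  refine ⟨s, hs0, n₀, fun n hn G H hHG hG hH ↦ ?_⟩
  have hns : 1 / s < n := hn₀.trans_le (by exact_mod_cast hn)
  have hn0 : (0 : ℝ) < n := (by positivity : (0 : ℝ) < 1 / s).trans hns
  have hns' : 1 / (n : ℝ) ≤ s := by
    rw [div_le_comm₀ hn0 hs0]; exact hns.le
  have : Nonempty (Fin n) := ⟨⟨0, by exact_mod_cast hn0⟩⟩
  have h1 := hG.le_expect_of_forall_dense ⟨hp0.le, hp1.le⟩ hHG hm2 (θ := α + η / 2)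
    (by positivity) (homInd_nonneg L H) fun x hx ↦
      exists_one_le_homInd hr hL H x (by exact_mod_cast hm.trans_lt hx)
  have hD : (α + η) * p - (α + η) * p * s
      ≤ 2 * H.edgeSet.ncard / (Fintype.card (Fin n) : ℝ) ^ 2 := by
    rw [Fintype.card_fin, le_div_iff₀ (by positivity)]
    rw [Nat.cast_choose_two] at hH
    have h2 : 1 ≤ s * n := by rwa [div_le_iff₀ hn0] at hns'
    have h3 : (α + η) * p * n * 1 ≤ (α + η) * p * n * (s * n) :=
      mul_le_mul_of_nonneg_left h2 (by positivity)
    linarith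
  have h2 : (p ^ (N - 1) * (p * (η / 2) - (α + η) * p * s) - (1 + (α + η / 2)) * N * s)
      / (m : ℝ) ^ Fintype.card W ≤ 𝔼 y, homInd L H y := by
    rw [div_le_iff₀' (by positivity)]
    refine le_trans ?_ h1
    refine sub_le_sub_right (mul_le_mul_of_nonneg_left ?_ (by positivity)) _
    linarith
  have hGc := hG.compl.mono (ε' := s + s) (by rw [Fintype.card_fin]; linarith)
  have h3 := hGc.abs_expect_prod_sub_le ⟨by linarith, by linarith⟩ (F := homInd L H) Lᶜ.edgeFinset
    (fun e he ↦ Lᶜ.not_isDiag_of_mem_edgeFinset he)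
    (fun a b hab ↦ splits_homInd H (by simpa using hab))
  have h4 : 0 < 𝔼 y, homInd L H y * ∏ e ∈ Lᶜ.edgeFinset, Gᶜ.edgeInd (e.map y) := by
    have h5 := mul_le_mul_of_nonneg_left h2 (pow_nonneg (show 0 ≤ 1 - p by linarith) q)
    have h6 : Φ s ≤ _ := sub_le_sub_right h5 _
    linarith [(abs_le.1 h3).1]
  obtain ⟨y, -, hy⟩ := exists_ne_zero_of_expect_ne_zero h4.ne'
  obtain ⟨hy1, hy2⟩ := mul_ne_zero_iff.1 hy
  obtain ⟨hLH, hsupp⟩ := of_homInd_ne_zero hy1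
  have hcompl : ∀ a b, a ≠ b → ¬ L.Adj a b → Gᶜ.Adj (y a) (y b) := fun a b hab hL ↦
    mem_edgeSet_of_edgeInd_ne_zero (prod_ne_zero_iff.1 hy2 s(a, b) (by simp [hab, hL]))
  have hinj : Injective y := by
    intro a b hab
    by_contra hne
    by_cases hL : L.Adj a b
    · exact (hLH a b hL).ne hab
    · exact (hcompl a b hne hL).ne hab
  refine ⟨⟨⟨y, hinj⟩, fun {a b} ↦ ⟨fun h ↦ ?_, hLH a b⟩⟩, hsupp⟩
  by_contra hL
  have hab : a ≠ b := by
    rintro rfl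
    exact H.irrefl h
  exact (hcompl a b hab hL).2 (hHG h)

end SimpleGraph

/-! ### Bichromatic subgraphs and membership in a hereditary property -/

namespace SimpleGraph

open Finset Function
open scoped BigOperators

/-- Some `r`-colouring of the vertices leaves at least the proportion `1 - 1 / r` of the edges
bichromatic, by averaging over all colourings. -/
lemma exists_colorable_le_edgeSet_ncard {V : Type*} [Fintype V] (G : SimpleGraph V) {r : ℕ}
    (hr : 0 < r) : ∃ H ≤ G, H.Colorable r ∧
      (1 - 1 / r : ℝ) * G.edgeSet.ncard ≤ H.edgeSet.ncard := by
  classical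
  have : Nonempty (Fin r) := ⟨⟨0, hr⟩⟩
  have hr0 : (0 : ℝ) < r := by exact_mod_cast hr
  -- a fixed pair is bichromatic with probability `1 - 1 / r`
  have hcol : ∀ e : Sym2 V, ¬ e.IsDiag →
      𝔼 c : V → Fin r, (⊤ : SimpleGraph (Fin r)).edgeInd (e.map c) = 1 - 1 / r := by
    intro e he
    rw [expect_edgeInd_map _ he, ← coe_edgeFinset, Set.ncard_coe_finset,
      card_edgeFinset_top_eq_card_choose_two, Fintype.card_fin, Nat.cast_choose_two]
    field_simp
  have havg : 𝔼 c : V → Fin r, ∑ e ∈ G.edgeFinset, (⊤ : SimpleGraph (Fin r)).edgeInd (e.map c)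
      = (1 - 1 / r) * G.edgeSet.ncard := by
    rw [expect_sum_comm, sum_congr rfl fun e he ↦ hcol e (G.not_isDiag_of_mem_edgeFinset he),
      sum_const, nsmul_eq_mul, ← coe_edgeFinset, Set.ncard_coe_finset, mul_comm]
  obtain ⟨c, -, hc⟩ := exists_le_of_le_expect univ_nonempty havg.ge
  refine ⟨G ⊓ (⊤ : SimpleGraph (Fin r)).comap c, inf_le_left,
    ⟨Coloring.mk c fun h ↦ h.2⟩, hc.trans (le_of_eq ?_)⟩
  have h : (G ⊓ (⊤ : SimpleGraph (Fin r)).comap c).edgeFinset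
      = {e ∈ G.edgeFinset | e.map c ∈ (⊤ : SimpleGraph (Fin r)).edgeSet} := by
    ext e
    induction e using Sym2.ind with
    | _ a b => simp
  rw [← coe_edgeFinset, Set.ncard_coe_finset, h, card_filter, Nat.cast_sum]
  refine sum_congr rfl fun e _ ↦ ?_
  unfold edgeInd
  split_ifs <;> simp

/-- A cut-uniform graph of density `p` has at least about `p n ^ 2 / 2` edges. -/
lemma IsCutUniform.le_ncard_edgeSet {n : ℕ} {G : SimpleGraph (Fin n)} {p ε : ℝ}
    (hG : G.IsCutUniform p ε) : (p - ε) * (n : ℝ) ^ 2 ≤ 2 * G.edgeSet.ncard := by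
  rcases n.eq_zero_or_pos with rfl | hn
  · simp
  have : Nonempty (Fin n) := ⟨⟨0, hn⟩⟩
  have h1 := hG.abs_expect_splits_le (W := Fin 2) (F := fun _ ↦ 1) zero_ne_one
    (.of_left (by simp) (by simp))
  have h2 := expect_edgeInd_map G (e := s((0 : Fin 2), 1)) (by simp)
  simp only [Sym2.map_mk] at h2
  simp only [one_mul, expect_sub_distrib, Fintype.expect_const, h2, Fintype.card_fin] at h1
  have h3 := (abs_le.1 h1).1
  have hn2 : (0 : ℝ) < (n : ℝ) ^ 2 := by positivity
  rw [← le_div_iff₀ hn2]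
  linarith

end SimpleGraph

namespace GraphProperty

open SimpleGraph

/-- A graph that is colourable with fewer than `k(P)` colours belongs to `P`. -/
lemma mem_of_colorable (P : GraphProperty) {V : Type} [Finite V] {H : SimpleGraph V} {r : ℕ}
    (hH : H.Colorable r) (hr : r < P.minMissedChromaticNumber) : P.Mem V H := by
  by_contra hP
  have htop : H.chromaticNumber ≠ ⊤ := chromaticNumber_ne_top_iff_exists.2 ⟨r, hH⟩
  obtain ⟨c, hc⟩ := ENat.ne_top_iff_exists.1 htop
  have hcr : c ≤ r := by
    have := hH.chromaticNumber_le
    rw [← hc] at this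
    exact_mod_cast this
  have : P.minMissedChromaticNumber ≤ c := Nat.sInf_le ⟨V, ‹_›, H, hP, hc.symm⟩
  omega

lemma two_le_minMissedChromaticNumber {P : GraphProperty} (hP : P.IsNontrivial) :
    2 ≤ P.minMissedChromaticNumber := by
  obtain ⟨V, hV, L, hL, hc⟩ := (isLeast_minMissedChromaticNumber hP).1
  by_contra! hlt
  refine hL ?_
  have h1 : L.Colorable 1 := by
    rw [← chromaticNumber_le_iff_colorable, hc]
    exact_mod_cast (by omega : P.minMissedChromaticNumber ≤ 1)
  obtain ⟨C⟩ := h1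
  have : L = ⊥ := by
    ext a b
    simpa using fun h ↦ C.valid h (Subsingleton.elim _ _)
  rw [this]
  exact hP.1 V

lemma ncard_edgeSet_le_ex {P : GraphProperty} (hP : P.IsNontrivial) {V : Type} [Finite V]
    {G H : SimpleGraph V} (hHG : H ≤ G) (hH : P.Mem V H) : H.edgeSet.ncard ≤ P.ex G := by
  refine (isGreatest_ex hP G).2 ⟨toSubgraph H hHG, ?_, ?_⟩
  · refine P.mem_of_iso ⟨(⟨(Equiv.Set.univ V).symm, ?_⟩ : H ≃g (toSubgraph H hHG).coe)⟩ hH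
    intro a b
    exact Iff.rfl
  · congr 1

/-- In a hereditary property, no member contains an induced copy of a non-member. -/
lemma IsHereditary.not_mem_coe {P : GraphProperty} (hP : P.IsHereditary) {V W : Type} [Finite V]
    [Finite W] {G : SimpleGraph V} {L : SimpleGraph W} (hL : ¬ P.Mem W L) (H : G.Subgraph)
    (f : L ↪g H.spanningCoe) (hf : ∀ w, f w ∈ H.spanningCoe.support) : ¬ P.Mem H.verts H.coe := by
  intro hH
  have hv : ∀ w, f w ∈ H.verts := by
    intro w
    obtain ⟨v, hv⟩ := hf w
    exact H.edge_vert hv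
  let g : L ↪g H.coe :=
    ⟨⟨fun w ↦ ⟨f w, hv w⟩, fun a b h ↦ f.injective (congrArg Subtype.val h)⟩, by
      intro a b
      exact f.map_adj_iff⟩
  exact hL (P.mem_of_iso ⟨g.isoInduceRange.symm⟩ (hP _ H.coe (Set.range g) hH))

end GraphProperty

/-! ### Quasirandomness of the binomial random graph -/

namespace SimpleGraph

open Finset Function
open scoped BigOperators

section FourCycles

variable {V : Type*} [Fintype V]

/-- The sum over all, possibly degenerate, four-cycles `u v u' v'` of the product of the four
deviations of the edge indicator of `G` from `p`. -/
noncomputable def cycleDeviation (G : SimpleGraph V) (p : ℝ) : ℝ :=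
  ∑ v, ∑ v', ∑ u, ∑ u', (G.edgeInd s(u, v) - p) * (G.edgeInd s(u, v') - p) *
    ((G.edgeInd s(u', v) - p) * (G.edgeInd s(u', v') - p))

lemma cycleDeviation_eq_sum_sq (G : SimpleGraph V) (p : ℝ) : G.cycleDeviation p =
    ∑ v, ∑ v', (∑ u, (G.edgeInd s(u, v) - p) * (G.edgeInd s(u, v') - p)) ^ 2 := by
  simp only [cycleDeviation, sq, sum_mul_sum]

lemma cycleDeviation_nonneg (G : SimpleGraph V) (p : ℝ) : 0 ≤ G.cycleDeviation p := by
  rw [cycleDeviation_eq_sum_sq]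
  exact sum_nonneg fun _ _ ↦ sum_nonneg fun _ _ ↦ sq_nonneg _

/-- Two applications of the Cauchy–Schwarz inequality bound the cut norm by four-cycles. -/
lemma isCutUniform_of_cycleDeviation_le [Nonempty V] {G : SimpleGraph V} {p ε : ℝ} (hε : 0 ≤ ε)
    (h : G.cycleDeviation p ≤ ε ^ 4 * (Fintype.card V : ℝ) ^ 4) : G.IsCutUniform p ε := by
  intro A B hA hB
  set n : ℝ := (Fintype.card V : ℝ)
  have hn : 0 < n := Nat.cast_pos.2 Fintype.card_pos
  set d : V → V → ℝ := fun u v ↦ G.edgeInd s(u, v) - p with hd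
  have hsq : ∀ t : ℝ, t ∈ Set.Icc 0 1 → t ^ 2 ≤ 1 := fun t ht ↦ pow_le_one₀ ht.1 ht.2
  set Y := ∑ u, (∑ v, B v * d u v) ^ 2
  have h1 : (∑ u, ∑ v, A u * B v * d u v) ^ 2 ≤ n * Y := by
    refine sq_sum_le_card_mul_sum_sq.trans ?_
    rw [card_univ]
    refine mul_le_mul_of_nonneg_left (sum_le_sum fun u _ ↦ ?_) hn.le
    simp only [mul_assoc, ← mul_sum]
    rw [mul_pow]
    exact mul_le_of_le_one_left (sq_nonneg _) (hsq _ (hA u))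
  have hY : Y = ∑ z : V × V, B z.1 * B z.2 * ∑ u, d u z.1 * d u z.2 := by
    have hsum : ∀ u, (∑ v, B v * d u v) ^ 2 = ∑ v, ∑ v', B v * d u v * (B v' * d u v') :=
      fun u ↦ by rw [sq, sum_mul_sum]
    simp only [Y, hsum, Fintype.sum_prod_type, mul_sum]
    rw [sum_comm]
    refine sum_congr rfl fun v _ ↦ ?_
    rw [sum_comm]
    exact sum_congr rfl fun v' _ ↦ sum_congr rfl fun u _ ↦ by ring
  have h2 : Y ^ 2 ≤ n ^ 2 * G.cycleDeviation p := by
    rw [hY, cycleDeviation_eq_sum_sq, ← Fintype.sum_prod_type']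
    refine sq_sum_le_card_mul_sum_sq.trans ?_
    rw [card_univ, Fintype.card_prod, Nat.cast_mul, ← sq]
    refine mul_le_mul_of_nonneg_left (sum_le_sum fun z _ ↦ ?_) (by positivity)
    rw [mul_pow, mul_pow]
    exact mul_le_of_le_one_left (sq_nonneg _)
      (mul_le_one₀ (hsq _ (hB _)) (sq_nonneg _) (hsq _ (hB _)))
  have hY0 : 0 ≤ Y := sum_nonneg fun _ _ ↦ sq_nonneg _
  have h3 : |∑ u, ∑ v, A u * B v * d u v| ^ 4 ≤ (ε * n ^ 2) ^ 4 := by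
    calc |∑ u, ∑ v, A u * B v * d u v| ^ 4 = ((∑ u, ∑ v, A u * B v * d u v) ^ 2) ^ 2 := by
          rw [show 4 = 2 * 2 from rfl, pow_mul, sq_abs]
      _ ≤ (n * Y) ^ 2 := by gcongr
      _ = n ^ 2 * Y ^ 2 := by ring
      _ ≤ n ^ 2 * (n ^ 2 * (ε ^ 4 * n ^ 4)) := by
          gcongr
          exact h2.trans (by gcongr)
      _ = (ε * n ^ 2) ^ 4 := by ring
  have h4 := le_of_pow_le_pow_left₀ (by norm_num) (by positivity) h3
  simp only [Fintype.expect_eq_sum_div_card]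
  rw [← sum_div, div_div, abs_div, abs_of_pos (by positivity : 0 < n * n),
    div_le_iff₀ (by positivity), ← sq]
  exact h4

end FourCycles

section BinomialRandom

variable {V : Type*}

lemma measurableSet_singleton_simpleGraph [Countable V] (G : SimpleGraph V) :
    MeasurableSet ({G} : Set (SimpleGraph V)) := by
  have : ({G} : Set (SimpleGraph V)) = ⋂ u, ⋂ v, {H | H.Adj u v ↔ G.Adj u v} := by
    ext H
    simp [SimpleGraph.ext_iff, funext_iff]
  rw [this]
  refine .iInter fun u ↦ .iInter fun v ↦ ?_
  have h : Measurable fun H : SimpleGraph V ↦ H.Adj u v := measurable_iff_adj.1 measurable_id u v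
  exact measurableSet_setOfPred.2 (h.iff measurable_const)

instance instMeasurableSingletonClass [Countable V] : MeasurableSingletonClass (SimpleGraph V) :=
  ⟨measurableSet_singleton_simpleGraph⟩

lemma binomialRandom_real_singleton [Fintype V] (p : unitInterval) (G : SimpleGraph V) :
    (binomialRandom V p).real {G} = (p : ℝ) ^ G.edgeSet.ncard *
      (1 - p) ^ ((Fintype.card V).choose 2 - G.edgeSet.ncard) := by
  rw [measureReal_def, binomialRandom_singleton]
  simp [Nat.card_eq_fintype_card]

lemma symmDiff_edge_adj {G : SimpleGraph V} {a b : V} (hab : a ≠ b) :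
    (symmDiff G (edge a b)).Adj a b ↔ ¬ G.Adj a b := by
  simp [symmDiff, edge_adj, hab]

lemma edgeInd_symmDiff_edge (G : SimpleGraph V) {a b : V} {e : Sym2 V} (he : e ≠ s(a, b)) :
    (symmDiff G (edge a b)).edgeInd e = G.edgeInd e := by
  have : e ∈ (symmDiff G (edge a b)).edgeSet ↔ e ∈ G.edgeSet := by
    induction e using Sym2.ind with
    | _ c d =>
      have : ¬ (edge a b).Adj c d := fun h ↦ he ((adj_edge _ _).1 h).1.symm
      rw [mem_edgeSet, mem_edgeSet, symmDiff, sup_adj, sdiff_adj, sdiff_adj]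
      tauto
  by_cases h : e ∈ G.edgeSet
  · rw [edgeInd_of_mem h, edgeInd_of_mem (this.2 h)]
  · rw [edgeInd_of_notMem h, edgeInd_of_notMem (mt this.1 h)]

/-- Adding an edge multiplies the probability of a graph by `p / (1 - p)`. -/
lemma binomialRandom_real_symmDiff_edge [Fintype V] (p : unitInterval) {G : SimpleGraph V} {a b : V}
    (hab : a ≠ b) (hG : ¬ G.Adj a b) :
    (binomialRandom V p).real {symmDiff G (edge a b)} * (1 - p)
      = (binomialRandom V p).real {G} * p := by
  classical
  have hcard : (symmDiff G (edge a b)).edgeSet.ncard = G.edgeSet.ncard + 1 := by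
    rw [((disjoint_edge _).2 hG).symmDiff_eq_sup, edgeSet_sup, edgeSet_edge_of_ne hab,
      Set.union_singleton, Set.ncard_insert_of_notMem (by simpa using hG)]
  have hle : (symmDiff G (edge a b)).edgeSet.ncard ≤ (Fintype.card V).choose 2 := by
    rw [← coe_edgeFinset, Set.ncard_coe_finset]
    exact card_edgeFinset_le_card_choose_two
  rw [hcard] at hle
  rw [binomialRandom_real_singleton, binomialRandom_real_singleton, hcard,
    show (Fintype.card V).choose 2 - G.edgeSet.ncard
      = (Fintype.card V).choose 2 - (G.edgeSet.ncard + 1) + 1 by omega]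
  ring

/-- The centred indicator of a pair has mean zero against every function of the other pairs. -/
lemma sum_binomialRandom_mul_edgeInd_sub_eq_zero [Fintype V] [DecidableEq V] (p : unitInterval)
    {a b : V} (hab : a ≠ b) {R : SimpleGraph V → ℝ} (hR : ∀ G, R (symmDiff G (edge a b)) = R G) :
    ∑ G, (binomialRandom V p).real {G} * ((G.edgeInd s(a, b) - p) * R G) = 0 := by
  set f : SimpleGraph V → ℝ :=
    fun G ↦ (binomialRandom V p).real {G} * ((G.edgeInd s(a, b) - p) * R G) with hf
  have hinv : Involutive fun G : SimpleGraph V ↦ symmDiff G (edge a b) :=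
    fun G ↦ symmDiff_symmDiff_cancel_right _ _
  have hneg : ∀ G, ¬ G.Adj a b → f (symmDiff G (edge a b)) = -f G := by
    intro G hG
    have h1 := binomialRandom_real_symmDiff_edge p hab hG
    simp only [hf, hR]
    rw [edgeInd_of_mem (show s(a, b) ∈ (symmDiff G (edge a b)).edgeSet from
        (symmDiff_edge_adj hab).2 hG), edgeInd_of_notMem (show s(a, b) ∉ G.edgeSet from hG),
      ← mul_assoc, h1]
    ring
  have hall : ∀ G, f (symmDiff G (edge a b)) = -f G := by
    intro G
    by_cases hG : G.Adj a b
    · have := hneg (symmDiff G (edge a b)) (by simpa [symmDiff_edge_adj hab] using hG)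
      rw [symmDiff_symmDiff_cancel_right] at this
      rw [this, neg_neg]
    · exact hneg G hG
  have h1 : ∑ G, f (symmDiff G (edge a b)) = ∑ G, f G := hinv.bijective.sum_comp f
  simp only [hall, sum_neg_distrib] at h1
  change ∑ G, f G = 0
  linarith

lemma sum_binomialRandom_real_singleton [Fintype V] [DecidableEq V] (p : unitInterval) :
    ∑ G, (binomialRandom V p).real {G} = 1 := by
  rw [sum_measureReal_singleton, coe_univ, probReal_univ]

lemma abs_edgeInd_sub_le_one (p : unitInterval) (G : SimpleGraph V) (e : Sym2 V) :
    |G.edgeInd e - p| ≤ 1 := by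
  rw [abs_le]
  constructor <;> linarith [edgeInd_nonneg G e, edgeInd_le_one G e, p.2.1, p.2.2]

/-- The expected four-cycle deviation is cubic in the number of vertices: only the degenerate
four-cycles contribute. -/
lemma sum_binomialRandom_mul_cycleDeviation_le [Fintype V] [DecidableEq V] (p : unitInterval) :
    ∑ G, (binomialRandom V p).real {G} * G.cycleDeviation p ≤ 4 * (Fintype.card V : ℝ) ^ 3 := by
  have hquad : ∀ v v' u u' : V, ∑ G, (binomialRandom V p).real {G} *
      ((G.edgeInd s(u, v) - p) * (G.edgeInd s(u, v') - p) *
        ((G.edgeInd s(u', v) - p) * (G.edgeInd s(u', v') - p)))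
      ≤ (if u = v then 1 else 0) + (if v = v' then 1 else 0) + (if u = u' then 1 else 0)
        + (if u = v' then (1 : ℝ) else 0) := by
    intro v v' u u'
    by_cases hnd : u ≠ v ∧ v ≠ v' ∧ u ≠ u' ∧ u ≠ v'
    · obtain ⟨h1, h2, h3, h4⟩ := hnd
      have := sum_binomialRandom_mul_edgeInd_sub_eq_zero p h1
        (R := fun G ↦ (G.edgeInd s(u, v') - p) *
          ((G.edgeInd s(u', v) - p) * (G.edgeInd s(u', v') - p))) fun G ↦ by
            rw [edgeInd_symmDiff_edge, edgeInd_symmDiff_edge, edgeInd_symmDiff_edge]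
            · simp [h3.symm, h4.symm]
            · simp [h3.symm, h1.symm]
            · simp [h2.symm, h1]
      simp only [mul_assoc] at this ⊢
      rw [this]
      positivity
    · have hle : ∑ G, (binomialRandom V p).real {G} *
          ((G.edgeInd s(u, v) - p) * (G.edgeInd s(u, v') - p) *
            ((G.edgeInd s(u', v) - p) * (G.edgeInd s(u', v') - p))) ≤ 1 := by
        rw [← sum_binomialRandom_real_singleton (V := V) p]
        refine sum_le_sum fun G _ ↦ mul_le_of_le_one_right measureReal_nonneg ?_
        refine (le_abs_self _).trans ?_
        simp only [abs_mul]
        have h := abs_edgeInd_sub_le_one p G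
        exact mul_le_one₀ (mul_le_one₀ (h _) (abs_nonneg _) (h _)) (by positivity)
          (mul_le_one₀ (h _) (abs_nonneg _) (h _))
      refine hle.trans ?_
      clear hle
      split_ifs <;> first | (norm_num; done) | exact absurd ⟨‹_›, ‹_›, ‹_›, ‹_›⟩ hnd
  have hswap : ∑ G, (binomialRandom V p).real {G} * G.cycleDeviation p
      = ∑ v, ∑ v', ∑ u, ∑ u', ∑ G, (binomialRandom V p).real {G} *
      ((G.edgeInd s(u, v) - p) * (G.edgeInd s(u, v') - p) *
        ((G.edgeInd s(u', v) - p) * (G.edgeInd s(u', v') - p))) := by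
    simp only [cycleDeviation, mul_sum]
    rw [sum_comm]
    refine sum_congr rfl fun v _ ↦ ?_
    rw [sum_comm]
    refine sum_congr rfl fun v' _ ↦ ?_
    rw [sum_comm]
    refine sum_congr rfl fun u _ ↦ ?_
    rw [sum_comm]
  rw [hswap]
  refine (sum_le_sum fun v _ ↦ sum_le_sum fun v' _ ↦ sum_le_sum fun u _ ↦ sum_le_sum fun u' _ ↦
    hquad v v' u u').trans (le_of_eq ?_)
  simp [sum_add_distrib]
  ring

/-- The binomial random graph is asymptotically almost surely cut-uniform of density `p`. -/
theorem tendsto_binomialRandom_isCutUniform (p : unitInterval) {ε : ℝ} (hε : 0 < ε) :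
    Tendsto (fun n : ℕ ↦ (binomialRandom (Fin n) p).real {G | G.IsCutUniform p ε}) atTop (𝓝 1) := by
  classical
  have hlim : Tendsto (fun n : ℕ ↦ 1 - 4 / ε ^ 4 / (n : ℝ)) atTop (𝓝 1) := by
    have := (tendsto_const_div_atTop_nhds_zero_nat (4 / ε ^ 4)).const_sub 1
    rwa [sub_zero] at this
  refine tendsto_of_tendsto_of_tendsto_of_le_of_le' hlim tendsto_const_nhds ?_
    (.of_forall fun n ↦ measureReal_le_one)
  filter_upwards [eventually_gt_atTop 0] with n hn
  have : Nonempty (Fin n) := ⟨⟨0, hn⟩⟩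
  have hn0 : (0 : ℝ) < n := by exact_mod_cast hn
  set μ := binomialRandom (Fin n) p
  have hbad : μ.real {G | G.IsCutUniform p ε}ᶜ ≤ 4 / ε ^ 4 / n := by
    have h1 : μ.real {G | G.IsCutUniform p ε}ᶜ
        = ∑ G ∈ {G : SimpleGraph (Fin n) | ¬ G.IsCutUniform p ε}, μ.real {G} := by
      rw [sum_measureReal_singleton]
      congr 1
      ext G
      simp
    rw [h1, div_div, le_div_iff₀ (by positivity)]
    have h2 : (∑ G ∈ {G : SimpleGraph (Fin n) | ¬ G.IsCutUniform p ε}, μ.real {G})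
        * (ε ^ 4 * (n : ℝ) ^ 4) ≤ 4 * (n : ℝ) ^ 3 := by
      have h3 := sum_binomialRandom_mul_cycleDeviation_le (V := Fin n) p
      rw [Fintype.card_fin] at h3
      refine le_trans ?_ h3
      rw [sum_mul]
      refine (sum_le_sum fun G hG ↦ mul_le_mul_of_nonneg_left ?_ measureReal_nonneg).trans
        (sum_le_sum_of_subset_of_nonneg (subset_univ _) fun G _ _ ↦
          mul_nonneg measureReal_nonneg (G.cycleDeviation_nonneg p))
      by_contra! hlt
      refine (mem_filter.1 hG).2 (isCutUniform_of_cycleDeviation_le hε.le ?_)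
      rw [Fintype.card_fin]
      exact hlt.le
    refine le_of_mul_le_mul_right ?_ (show (0 : ℝ) < (n : ℝ) ^ 3 by positivity)
    linarith
  rw [probReal_compl_eq_one_sub (Set.toFinite _).measurableSet] at hbad
  linarith

end BinomialRandom

end SimpleGraph

/-! ### The extremal number of a cut-uniform graph -/

/-- Concentration at every fixed scale `η` implies concentration at a scale tending to zero. -/
lemma exists_tendsto_zero_of_forall_tendsto_one {f : ℕ → ℝ → ℝ} (hf : ∀ n η, f n η ≤ 1)
    (h0 : ∀ n η, 0 ≤ f n η)
    (h : ∀ η > 0, Tendsto (fun n ↦ f n η) atTop (𝓝 1)) :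
    ∃ δ : ℕ → ℝ, Tendsto δ atTop (𝓝 0) ∧ Tendsto (fun n ↦ f n (δ n)) atTop (𝓝 1) := by
  -- `δ n` nearly attains the Ky Fan distance `sInf (S n)`
  set S : ℕ → Set ℝ := fun n ↦ {η | 0 < η ∧ 1 - η ≤ f n η} with hS
  have hne : ∀ n, (S n).Nonempty := fun n ↦ ⟨1, one_pos, by simpa using h0 n 1⟩
  have hbdd : ∀ n, BddBelow (S n) := fun n ↦ ⟨0, fun η hη ↦ hη.1.le⟩
  have hex : ∀ n : ℕ, ∃ η ∈ S n, η < sInf (S n) + 1 / ((n : ℝ) + 1) := fun n ↦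
    exists_lt_of_csInf_lt (hne n) (lt_add_of_pos_right _ Nat.one_div_pos_of_nat)
  choose δ hδS hδ using hex
  have hinf : Tendsto (fun n ↦ sInf (S n)) atTop (𝓝 0) := by
    rw [Metric.tendsto_atTop']
    intro η hη
    obtain ⟨N, hN⟩ := eventually_atTop.1
      ((h (η / 2) (half_pos hη)).eventually_const_le (show 1 - η / 2 < 1 by linarith))
    refine ⟨N, fun n hn ↦ ?_⟩
    rw [Real.dist_0_eq_abs, abs_of_nonneg (Real.sInf_nonneg fun x hx ↦ hx.1.le)]
    exact (csInf_le (hbdd n) ⟨half_pos hη, hN n hn.le⟩).trans_lt (half_lt_self hη)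
  have hδ0 : Tendsto δ atTop (𝓝 0) := by
    refine squeeze_zero (fun n ↦ (hδS n).1.le) (fun n ↦ (hδ n).le) ?_
    simpa using hinf.add tendsto_one_div_add_atTop_nhds_zero_nat
  refine ⟨δ, hδ0, tendsto_of_tendsto_of_tendsto_of_le_of_le (g := fun n ↦ 1 - δ n) ?_
    tendsto_const_nhds (fun n ↦ (hδS n).2) fun n ↦ hf n _⟩
  simpa using hδ0.const_sub 1

namespace GraphProperty

open SimpleGraph

/-- Deterministic form: `ex(G, P)` is determined up to `η p (n choose 2)` once `G` is sufficiently
cut-uniform of density `p`. -/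
theorem abs_ex_sub_le_of_isCutUniform {P : GraphProperty} (hP : P.IsHereditary)
    (hnt : P.IsNontrivial) {p η : ℝ} (hp0 : 0 < p) (hp1 : p < 1) (hη : 0 < η) :
    ∃ ε > 0, ∃ n₀ : ℕ, ∀ n ≥ n₀, ∀ G : SimpleGraph (Fin n), G.IsCutUniform p ε →
      |(P.ex G : ℝ) - (1 - 1 / ((P.minMissedChromaticNumber : ℝ) - 1)) * p * n.choose 2|
        ≤ η * p * n.choose 2 := by
  have hk := two_le_minMissedChromaticNumber hnt
  obtain ⟨W, hW, L, hL, hχ⟩ := (isLeast_minMissedChromaticNumber hnt).1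
  obtain ⟨r, hr⟩ : ∃ r, P.minMissedChromaticNumber = r + 1 :=
    ⟨_, (Nat.sub_add_cancel (by omega)).symm⟩
  have hr0 : 0 < r := by omega
  have hcast : (P.minMissedChromaticNumber : ℝ) - 1 = r := by rw [hr]; push_cast; ring
  have hcol : L.Colorable (r + 1) := by
    rw [← chromaticNumber_le_iff_colorable, hχ, hr]
  obtain ⟨ε, hε, n₀, hup⟩ := exists_induced_copy_of_dense hr0 hcol hp0 hp1 hη
  refine ⟨min ε (p * η / 2), by positivity, max n₀ 2, fun n hn G hG ↦ ?_⟩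
  have hn2 : (2 : ℝ) ≤ n := by exact_mod_cast (le_max_right _ _).trans hn
  rw [hcast]
  set α : ℝ := 1 - 1 / r with hα
  have hα0 : 0 ≤ α := by
    rw [hα, sub_nonneg, div_le_one (by positivity)]; exact_mod_cast hr0
  have hα1 : α ≤ 1 := by
    rw [hα]; linarith [show (0 : ℝ) ≤ 1 / r by positivity]
  rw [abs_le]
  constructor
  · obtain ⟨H, hHG, hHc, hH⟩ := exists_colorable_le_edgeSet_ncard G hr0
    have h1 : (H.edgeSet.ncard : ℝ) ≤ P.ex G := by
      exact_mod_cast ncard_edgeSet_le_ex hnt hHG (P.mem_of_colorable hHc (by omega))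
    have h2 := mul_le_mul_of_nonneg_left
      (hG.mono (min_le_right ε (p * η / 2))).le_ncard_edgeSet hα0
    have h3 : 0 ≤ α * p * n := by positivity
    have h4 : 0 ≤ p * η * n * (2 * (n - 1) - α * n) := by
      refine mul_nonneg (by positivity) ?_
      linarith [mul_le_mul_of_nonneg_right hα1 (zero_le_two.trans hn2)]
    rw [Nat.cast_choose_two]
    linarith
  · by_contra! hlt
    obtain ⟨H, hH, hcard⟩ := (isGreatest_ex hnt G).1
    obtain ⟨f, hf⟩ := hup n ((le_max_left _ _).trans hn) G H.spanningCoe H.spanningCoe_le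
      (hG.mono (min_le_left _ _)) (by
      have : H.spanningCoe.edgeSet = H.edgeSet := by
        ext e
        induction e using Sym2.ind with
        | _ a b => simp
      rw [this, hcard]
      linarith)
    exact hP.not_mem_coe hL H f hf hH

end GraphProperty

theorem theorem1p1 (P : GraphProperty) (hP : P.IsHereditary) (hnt : P.IsNontrivial) :
    2 ≤ P.minMissedChromaticNumber ∧
    ∀ p : unitInterval, 0 < p → p < 1 →
      ∃ δ : ℕ → ℝ, Tendsto δ atTop (𝓝 0) ∧
        Tendsto (fun n : ℕ =>
            (SimpleGraph.binomialRandom (Fin n) p).real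
              {G : SimpleGraph (Fin n) |
                |(P.ex G : ℝ)
                    - (1 - 1 / ((P.minMissedChromaticNumber : ℝ) - 1)) * (p : ℝ) * (n.choose 2 : ℝ)|
                  ≤ δ n * (p : ℝ) * (n.choose 2 : ℝ)})
          atTop (𝓝 1) := by
  refine ⟨GraphProperty.two_le_minMissedChromaticNumber hnt, fun p hp0 hp1 ↦ ?_⟩
  refine exists_tendsto_zero_of_forall_tendsto_one
    (f := fun n η ↦ (SimpleGraph.binomialRandom (Fin n) p).real {G : SimpleGraph (Fin n) |
      |(P.ex G : ℝ) - (1 - 1 / ((P.minMissedChromaticNumber : ℝ) - 1)) * (p : ℝ) *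
        (n.choose 2 : ℝ)| ≤ η * (p : ℝ) * (n.choose 2 : ℝ)})
    (fun n η ↦ measureReal_le_one) (fun n η ↦ measureReal_nonneg) fun η hη ↦ ?_
  obtain ⟨ε, hε, n₀, h⟩ := GraphProperty.abs_ex_sub_le_of_isCutUniform hP hnt (p := p)
    (by exact_mod_cast hp0) (by exact_mod_cast hp1) hη
  refine tendsto_of_tendsto_of_tendsto_of_le_of_le'
    (SimpleGraph.tendsto_binomialRandom_isCutUniform p hε) tendsto_const_nhds ?_
    (.of_forall fun n ↦ measureReal_le_one)
  filter_upwards [eventually_ge_atTop n₀] with n hn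
  exact measureReal_mono fun G hG ↦ h n hn G hG
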